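/- Let $n,k,r$ be integers with $n\ge k\ge 5$ and $\lfloor (k-1)/2\rfloor+2\le r<k$. Let $\mathrm{ex}(m,K_r)$ denote the maximum number of edges of an $m$-vertex graph that contains no complete graph $K_r$, and put $$g_r(n,a,k)=a(n-k+a)+\mathrm{ex}(k-a,K_r).$$ Then the maximum number of edges in a $2$-connected $n$-vertex graph that contains neither $K_r$ nor any cycle of length at least $k$ as a (not necessarily induced) subgraph is equal to $$\max\left\{g_r(n,2,k),\ g_r\!\left(n,\left\lfloor \tfrac{k-1}{2}\right\rfloor,k\right)\right\}.$$ (In particular such graphs exist and the maximum is attained.) -/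

import Mathlib

/-- A finite graph is 2-connected if it has at least three vertices, is connected, and remains
connected after the deletion of any single vertex. -/
def IsTwoConnected {V : Type*} [Fintype V] (G : SimpleGraph V) : Prop :=
  3 ≤ Fintype.card V ∧ G.Connected ∧ ∀ v : V, (G.induce {v}ᶜ).Connected

/-- `G` contains no cycle of length at least `k` as a subgraph. -/
def LongCycleFree {V : Type*} (G : SimpleGraph V) (k : ℕ) : Prop :=
  ∀ (v : V) (p : G.Walk v v), p.IsCycle → p.length < k

/-- The set of all numbers of edges of 2-connected graphs on `n` vertices that contain neither
`K_r` nor a cycle of length at least `k`. -/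
def twoConnEdgeCounts (n r k : ℕ) : Set ℕ :=
  {m | ∃ G : SimpleGraph (Fin n),
    IsTwoConnected G ∧ G.CliqueFree r ∧ LongCycleFree G k ∧ G.edgeSet.ncard = m}

/-- `g_r(n, a, k) = a (n - k + a) + ex(k - a, K_r)`; it is used for `a ≤ k ≤ n` only, where the
subtractions are exact. -/
noncomputable def gTuran (r n a k : ℕ) : ℕ :=
  a * (n - k + a) + SimpleGraph.extremalNumber (k - a) (⊤ : SimpleGraph (Fin r))

/-!
Enlarge `G` to a maximal graph without cycles of length at least `k`; it is still 2-connected.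
By Pósa's argument, a path on at least `k` vertices whose nonadjacent ends have degrees `α` and `β`
within it leads, in a 2-connected graph, to a cycle of length at least `min k (α + β)`. In the
enlarged graph, nonadjacent vertices are joined by a path on at least `k` vertices. If they lie in
cores of minimum degrees adding up to at least `k`, a longest such path between the two cores
contains all neighbours of its ends in these cores, a contradiction. So with `t = (k - 1) / 2` the
`(t + 1)`-core is empty or a clique `K`, and then `K` is also the `(k + 1 - |K|)`-core. Deleting
vertices of degree at most `a` from the enlarged graph until `k - a` remain, with `a = t` or
`a = k - |K|`, bounds the number of edges of `G` by `g_r(n, a, k)`. As Turán numbers are convex,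
this bound is largest at an end of the range `2 ≤ a ≤ t`.

Equality holds for a Turán graph on `k - a` vertices, `a` of which, of distinct colours, are joined
to all further vertices. These `a` vertices cut a cycle into at most `a` segments, each a single
outer vertex or contained in the other `k - 2 * a` vertices of the Turán graph, so that the cycle
has at most `a + (a - 1) + (k - 2 * a) = k - 1` vertices.
-/

open SimpleGraph Walk Finset

section Paths

variable {V : Type*} {G : SimpleGraph V} {u v w : V}

theorem isPath_append_iff {p : G.Walk u v} {q : G.Walk v w} :
    (p.append q).IsPath ↔
      p.IsPath ∧ q.IsPath ∧ ∀ z, z ∈ p.support → z ∈ q.support → z = v := by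
  rw [isPath_def, isPath_def, isPath_def, support_append, List.nodup_append']
  have hq : q.support.Nodup ↔ v ∉ q.support.tail ∧ q.support.tail.Nodup := by
    rw [← List.nodup_cons, cons_tail_support]
  have hv := p.end_mem_support
  have hmem : ∀ z, z ∈ q.support ↔ z = v ∨ z ∈ q.support.tail := fun z => q.mem_support_iff
  simp only [List.Disjoint]
  grind

theorem isCycle_append_of_forall_mem_support {p : G.Walk u v} {q : G.Walk v u} (hp : p.IsPath)
    (hq : q.IsPath) (hpq : ∀ z, z ∈ p.support → z ∈ q.support → z = u ∨ z = v)
    (hlen : 1 < p.length) : (p.append q).IsCycle := by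
  have hu : u ∉ p.support.tail := (List.nodup_cons.1 (p.cons_tail_support ▸ hp.support_nodup)).1
  have hv : v ∉ q.support.tail := (List.nodup_cons.1 (q.cons_tail_support ▸ hq.support_nodup)).1
  refine hp.isCycle_append hq (fun z hzp hzq => ?_) (.inl hlen)
  obtain rfl | rfl := hpq z (List.mem_of_mem_tail hzp) (List.mem_of_mem_tail hzq)
  · exact hu hzp
  · exact hv hzq

theorem exists_append_first (p : G.Walk u v) {P : V → Prop} (hP : ∃ w ∈ p.support, P w) :
    ∃ (w : V) (q : G.Walk u w) (r : G.Walk w v),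
      p = q.append r ∧ P w ∧ ∀ z ∈ q.support, P z → z = w := by
  induction p with
  | nil => exact ⟨_, nil, nil, rfl, by simpa using hP, by simp⟩
  | @cons u u' v h p ih =>
    by_cases hu : P u
    · exact ⟨u, nil, cons h p, rfl, hu, by simp⟩
    · obtain ⟨w, q, r, rfl, hw, hq⟩ := ih (by simpa [hu] using hP)
      exact ⟨w, cons h q, r, rfl, hw, by simpa [hu] using hq⟩

theorem exists_append_last (p : G.Walk u v) {P : V → Prop} (hP : ∃ w ∈ p.support, P w) :
    ∃ (w : V) (q : G.Walk u w) (r : G.Walk w v),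
      p = q.append r ∧ P w ∧ ∀ z ∈ r.support, P z → z = w := by
  obtain ⟨w, q, r, hp, hw, hq⟩ := exists_append_first p.reverse (by simpa using hP)
  refine ⟨w, r.reverse, q.reverse, ?_, hw, by simpa using hq⟩
  rw [← reverse_append, ← hp, reverse_reverse]

end Paths

/-- A path from `A` to `B` in Diestel's sense: it meets `A` exactly in its first vertex and `B`
exactly in its last one. -/
structure IsPathBetween {V : Type*} {G : SimpleGraph V} {u v : V} (p : G.Walk u v)
    (A B : Set V) : Prop where
  isPath : p.IsPath
  mem_left_iff : ∀ w ∈ p.support, w ∈ A ↔ w = u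
  mem_right_iff : ∀ w ∈ p.support, w ∈ B ↔ w = v

/-- Two disjoint paths from `A` to `B`, as provided by Menger's theorem for 2-connected graphs. -/
structure IsLinkage {V : Type*} {G : SimpleGraph V} {s t s' t' : V} (p : G.Walk s t)
    (q : G.Walk s' t') (A B : Set V) : Prop where
  fst : IsPathBetween p A B
  snd : IsPathBetween q A B
  disjoint : p.support.Disjoint q.support

section Linkages

variable {V : Type*} {G : SimpleGraph V} {A B C : Set V} {b u v w s t s' t' x x' : V}

theorem IsPathBetween.start_mem {p : G.Walk u v} (hp : IsPathBetween p A B) : u ∈ A :=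
  (hp.mem_left_iff u p.start_mem_support).2 rfl

theorem IsPathBetween.end_mem {p : G.Walk u v} (hp : IsPathBetween p A B) : v ∈ B :=
  (hp.mem_right_iff v p.end_mem_support).2 rfl

theorem exists_isPathBetween {p : G.Walk u v} (hp : p.IsPath) (hu : u ∈ A) (hv : v ∈ B) :
    ∃ (s t : V) (q : G.Walk s t), IsPathBetween q A B ∧ q.support ⊆ p.support := by
  obtain ⟨t, p₁, p₂, rfl, ht, htB⟩ := exists_append_first p (P := (· ∈ B))
    ⟨v, p.end_mem_support, hv⟩
  obtain ⟨s, q₁, q₂, rfl, hs, hsA⟩ := exists_append_last p₁ (P := (· ∈ A))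
    ⟨u, p₁.start_mem_support, hu⟩
  have hmem : ∀ z ∈ q₂.support, z ∈ (q₁.append q₂).support := fun z hz =>
    (mem_support_append_iff _ _).2 (.inr hz)
  refine ⟨s, t, q₂, ⟨hp.of_append_left.of_append_right,
    fun z hz => ⟨hsA z hz, fun h => h ▸ hs⟩,
    fun z hz => ⟨htB z (hmem z hz), fun h => h ▸ ht⟩⟩, fun z hz => ?_⟩
  exact (mem_support_append_iff _ _).2 (.inl (hmem z hz))

theorem IsPathBetween.append {p : G.Walk s x} {q : G.Walk x t} (hp : IsPathBetween p A C)
    (hq : IsPathBetween q (insert x A) B) (hqC : ∀ z ∈ q.support, z ∈ C) (hBC : B ⊆ C) :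
    IsPathBetween (p.append q) A B := by
  have hpq : ∀ z ∈ p.support, z ∈ C → z = x := fun z hz => (hp.mem_right_iff z hz).1
  refine ⟨isPath_append_iff.2 ⟨hp.isPath, hq.isPath, fun z hz hzq => hpq z hz (hqC z hzq)⟩,
    fun z hz => ?_, fun z hz => ?_⟩
  · refine ⟨fun hzA => ?_, fun h => h ▸ hp.start_mem⟩
    have hzp : z ∈ p.support := by
      obtain hz | hz := (mem_support_append_iff p q).1 hz
      · exact hz
      · exact (hq.mem_left_iff z hz).1 (.inr hzA) ▸ p.end_mem_support
    exact (hp.mem_left_iff z hzp).1 hzA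
  · refine ⟨fun hzB => ?_, fun h => h ▸ hq.end_mem⟩
    have hzq : z ∈ q.support := by
      obtain hz | hz := (mem_support_append_iff p q).1 hz
      · exact hpq z hz (hBC hzB) ▸ q.start_mem_support
      · exact hz
    exact (hq.mem_right_iff z hzq).1 hzB

theorem IsPathBetween.mono_left {p : G.Walk u v} {A' : Set V} (hp : IsPathBetween p A B)
    (hA : A' ⊆ A) (hu : u ∈ A') : IsPathBetween p A' B :=
  ⟨hp.isPath, fun z hz => ⟨fun h => (hp.mem_left_iff z hz).1 (hA h), fun h => h ▸ hu⟩,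
    hp.mem_right_iff⟩

theorem IsLinkage.symm {p : G.Walk s t} {q : G.Walk s' t'} (h : IsLinkage p q A B) :
    IsLinkage q p A B :=
  ⟨h.snd, h.fst, h.disjoint.symm⟩

theorem IsLinkage.append {p : G.Walk s x} {p' : G.Walk s' x'} {q : G.Walk x t}
    {q' : G.Walk x' t'} (hp : IsLinkage p p' A C) (hq : IsLinkage q q' (insert x (insert x' A)) B)
    (hqC : ∀ z ∈ q.support, z ∈ C) (hqC' : ∀ z ∈ q'.support, z ∈ C) (hBC : B ⊆ C) :
    IsLinkage (p.append q) (p'.append q') A B where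
  fst := hp.fst.append
    (hq.fst.mono_left (Set.insert_subset_insert (Set.subset_insert _ _)) (Set.mem_insert _ _))
    hqC hBC
  snd := hp.snd.append (hq.snd.mono_left (Set.subset_insert _ _) (Set.mem_insert _ _)) hqC' hBC
  disjoint := by
    intro z hz hz'
    rw [mem_support_append_iff] at hz hz'
    have hpx : ∀ z ∈ p.support, z ∈ C → z = x := fun z hz => (hp.fst.mem_right_iff z hz).1
    have hpx' : ∀ z ∈ p'.support, z ∈ C → z = x' := fun z hz => (hp.snd.mem_right_iff z hz).1
    obtain hz | hz := hz <;> obtain hz' | hz' := hz'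
    · exact hp.disjoint hz hz'
    · exact hq.disjoint (hpx z hz (hqC' z hz') ▸ q.start_mem_support) hz'
    · exact hq.disjoint hz (hpx' z hz' (hqC z hz) ▸ q'.start_mem_support)
    · exact hq.disjoint hz hz'

theorem IsLinkage.isCycle {Q : G.Walk s t} {Q' : G.Walk s' t'} (h : IsLinkage Q Q' A B)
    {α : G.Walk s s'} {β : G.Walk t t'} (hα : α.IsPath) (hβ : β.IsPath)
    (hαA : ∀ z ∈ α.support, z ∈ A) (hβB : ∀ z ∈ β.support, z ∈ B)
    (hAB : ∀ z ∈ A, z ∈ B → z = s) : ((α.append Q').append (Q.append β).reverse).IsCycle := by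
  have hss' : s ≠ s' := fun hs => h.disjoint (hs ▸ Q.start_mem_support) Q'.start_mem_support
  have hs't' : s' ≠ t' := fun hs => hss' (hAB s' h.snd.start_mem (hs ▸ h.snd.end_mem)).symm
  have hlen : 1 < (α.append Q').length := by
    have := not_nil_iff_lt_length.1 (α.not_nil_of_ne hss')
    have := not_nil_iff_lt_length.1 (Q'.not_nil_of_ne hs't')
    grind [length_append]
  have hαQ : ∀ z ∈ α.support, z ∈ Q.support → z = s := fun z hz hzQ =>
    (h.fst.mem_left_iff z hzQ).1 (hαA z hz)
  have hαQ' : ∀ z ∈ α.support, z ∈ Q'.support → z = s' := fun z hz hzQ =>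
    (h.snd.mem_left_iff z hzQ).1 (hαA z hz)
  have hQβ : ∀ z ∈ Q.support, z ∈ β.support → z = t := fun z hz hzβ =>
    (h.fst.mem_right_iff z hz).1 (hβB z hzβ)
  have hQβ' : ∀ z ∈ Q'.support, z ∈ β.support → z = t' := fun z hz hzβ =>
    (h.snd.mem_right_iff z hz).1 (hβB z hzβ)
  refine isCycle_append_of_forall_mem_support
    (isPath_append_iff.2 ⟨hα, h.snd.isPath, hαQ'⟩)
    (isPath_append_iff.2 ⟨h.fst.isPath, hβ, hQβ⟩).reverse (fun z hz hz' => ?_) hlen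
  rw [support_reverse, List.mem_reverse] at hz'
  rw [mem_support_append_iff] at hz hz'
  obtain hz | hz := hz <;> obtain hz' | hz' := hz'
  · exact .inl (hαQ z hz hz')
  · exact .inl (hAB z (hαA z hz) (hβB z hz'))
  · exact absurd hz (h.disjoint hz')
  · exact .inr (hQβ' z hz hz')

theorem IsPathBetween.of_sdiff_singleton {p : G.Walk u v} (hp : IsPathBetween p A (B \ {b}))
    (hb : b ∉ p.support) : IsPathBetween p A B :=
  ⟨hp.isPath, hp.mem_left_iff, fun z hz => ⟨fun hzB => (hp.mem_right_iff z hz).1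
    ⟨hzB, fun h => hb (h ▸ hz)⟩, fun h => ((hp.mem_right_iff z hz).2 h).1⟩⟩

theorem IsPathBetween.of_append_left {p : G.Walk u w} {q : G.Walk w v}
    (h : IsPathBetween (p.append q) A B) (hwv : w ≠ v) (hC : ∀ z ∈ p.support, z ∈ C → z = w) :
    IsPathBetween p A (B ∪ {z | z ∈ q.support ∨ z ∈ C}) := by
  obtain ⟨hp, -, hpq⟩ := isPath_append_iff.1 h.isPath
  have hmem : ∀ z ∈ p.support, z ∈ (p.append q).support := fun z hz =>
    (mem_support_append_iff _ _).2 (.inl hz)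
  refine ⟨hp, fun z hz => h.mem_left_iff z (hmem z hz), fun z hz =>
    ⟨?_, fun hzw => .inr (.inl (hzw ▸ q.start_mem_support))⟩⟩
  rintro (hzB | hzq | hzC)
  · have hzv := (h.mem_right_iff z (hmem z hz)).1 hzB
    exact absurd (hpq v (hzv ▸ hz) q.end_mem_support) hwv.symm
  · exact hpq z hz hzq
  · exact hC z hz hzC

theorem IsPathBetween.of_append_right {p : G.Walk u w} {q : G.Walk w v}
    (h : IsPathBetween (p.append q) A B) : IsPathBetween q (insert w A) B := by
  obtain ⟨-, hq, hpq⟩ := isPath_append_iff.1 h.isPath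
  have hmem : ∀ z ∈ q.support, z ∈ (p.append q).support := fun z hz =>
    (mem_support_append_iff _ _).2 (.inr hz)
  refine ⟨hq, fun z hz => ⟨fun hzA => hzA.elim id fun hzA => ?_, .inl⟩,
    fun z hz => h.mem_right_iff z (hmem z hz)⟩
  exact hpq z ((h.mem_left_iff z (hmem z hz)).1 hzA ▸ p.start_mem_support) hz

theorem IsPathBetween.isLinkage_of_append {p : G.Walk u b} {q₁ : G.Walk u w} {q₂ : G.Walk w v}
    (hp : IsPathBetween p (insert u A) B) (hq : IsPathBetween (q₁.append q₂) (insert u A) B)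
    (hpq : ∀ z ∈ p.support, z ∈ (q₁.append q₂).support → z = u) (hwu : w ≠ u) :
    IsLinkage p q₂ (insert u (insert w A)) B := by
  have hmem : ∀ z ∈ q₂.support, z ∈ (q₁.append q₂).support := fun z hz =>
    (mem_support_append_iff _ _).2 (.inr hz)
  have hu : u ∉ q₂.support := fun hu =>
    hwu ((isPath_append_iff.1 hq.isPath).2.2 u q₁.start_mem_support hu).symm
  have hw : w ∉ p.support := fun hw => hwu (hpq w hw (hmem w q₂.start_mem_support))
  refine ⟨⟨hp.isPath, fun z hz => ?_, hp.mem_right_iff⟩,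
    ⟨hq.isPath.of_append_right, fun z hz => ?_, fun z hz => hq.mem_right_iff z (hmem z hz)⟩,
    fun z hz hz' => hu (hpq z hz (hmem z hz') ▸ hz')⟩
  · have := hp.mem_left_iff z hz
    grind
  · have := hq.mem_left_iff z (hmem z hz)
    grind

theorem IsLinkage.exists_of_fork {Q : G.Walk s u} {Q' : G.Walk s' w} {p : G.Walk u b}
    {q : G.Walk u v} (hQ : IsLinkage Q Q' A (B ∪ {z | z ∈ p.support ∨ z ∈ q.support}))
    (hp : IsPathBetween p (insert u A) B) (hq : IsPathBetween q (insert u A) B)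
    (hpq : ∀ z ∈ p.support, z ∈ q.support → z = u) :
    ∃ (x x' t : V) (R : G.Walk x b) (R' : G.Walk x' t),
      IsLinkage R R' A B ∧ (x = s ∧ x' = s' ∨ x = s' ∧ x' = s) := by
  have hwu : w ≠ u := fun h => hQ.disjoint (h ▸ Q.end_mem_support) Q'.end_mem_support
  have hpC : ∀ z ∈ p.support, z ∈ B ∪ {z | z ∈ p.support ∨ z ∈ q.support} :=
    fun z hz => .inr (.inl hz)
  have hqC : ∀ z ∈ q.support, z ∈ B ∪ {z | z ∈ p.support ∨ z ∈ q.support} :=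
    fun z hz => .inr (.inr hz)
  by_cases hwp : w ∈ p.support
  · obtain ⟨p₁, p₂, rfl⟩ := Walk.mem_support_iff_exists_append.1 hwp
    have hlink := (hq.isLinkage_of_append hp (fun z hz hz' => hpq z hz' hz) hwu)
    exact ⟨s', s, v, _, _, (hQ.append hlink hqC
      (fun z hz => hpC z ((mem_support_append_iff _ _).2 (.inr hz)))
      Set.subset_union_left).symm, .inr ⟨rfl, rfl⟩⟩
  by_cases hwq : w ∈ q.support
  · obtain ⟨q₁, q₂, rfl⟩ := Walk.mem_support_iff_exists_append.1 hwq
    exact ⟨s, s', v, _, _, hQ.append (hp.isLinkage_of_append hq hpq hwu) hpC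
      (fun z hz => hqC z ((mem_support_append_iff _ _).2 (.inr hz)))
      Set.subset_union_left, .inl ⟨rfl, rfl⟩⟩
  · have hwB : w ∈ B := hQ.snd.end_mem.resolve_right (not_or.2 ⟨hwp, hwq⟩)
    have hlink : IsLinkage p (nil : G.Walk w w) (insert u (insert w A)) B := by
      refine ⟨⟨hp.isPath, fun z hz => ?_, hp.mem_right_iff⟩, ⟨.nil, ?_, ?_⟩, ?_⟩
      · have := hp.mem_left_iff z hz
        grind
      all_goals simp [hwB, hwp, List.disjoint_singleton]
    exact ⟨s, s', w, _, _, hQ.append hlink hpC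
      (by simpa using .inl hwB) Set.subset_union_left, .inl ⟨rfl, rfl⟩⟩

end Linkages

section TwoConnected

variable {V : Type*} [Fintype V] {G G' : SimpleGraph V} {A B : Set V} {a b u v w : V}

theorem IsTwoConnected.mono (h : IsTwoConnected G) (hG : G ≤ G') : IsTwoConnected G' :=
  ⟨h.1, h.2.1.mono hG, fun v => (h.2.2 v).mono (comap_monotone _ hG)⟩

theorem IsTwoConnected.exists_isPath_notMem_support (h : IsTwoConnected G) (hu : u ≠ w)
    (hv : v ≠ w) : ∃ p : G.Walk u v, p.IsPath ∧ w ∉ p.support := by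
  obtain ⟨p, hp⟩ := ((h.2.2 w).preconnected ⟨u, Set.mem_compl_singleton_iff.2 hu⟩
    ⟨v, Set.mem_compl_singleton_iff.2 hv⟩).exists_isPath
  have hw : w ∉ (p.map (Embedding.induce _).toHom).support := by
    rw [Walk.support_map, List.mem_map]
    rintro ⟨z, -, hz⟩
    exact z.2 hz
  exact ⟨_, hp.map Subtype.val_injective, hw⟩

/-- The augmentation step in the proof of Menger's theorem, for one given path. -/
theorem IsTwoConnected.exists_isLinkage (h : IsTwoConnected G) (hA : A.Nontrivial)
    (hB : B.Nontrivial) {P : G.Walk a b} (hP : IsPathBetween P A B) :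
    ∃ (s s' t : V) (Q : G.Walk s b) (Q' : G.Walk s' t), IsLinkage Q Q' A B ∧ (a = s ∨ a = s') := by
  induction hn : P.length using Nat.strong_induction_on generalizing b B with
  | _ n ih =>
  obtain ⟨a', ha', ha'b⟩ := hA.exists_ne b
  obtain ⟨b', hb', hb'b⟩ := hB.exists_ne b
  obtain ⟨p, hp, hbp⟩ := h.exists_isPath_notMem_support ha'b hb'b
  obtain ⟨z, r, R, hR', hRp⟩ := exists_isPathBetween hp (A := A ∪ {v | v ∈ P.support})
    (B := B \ {b}) (.inl ha') ⟨hb', hb'b⟩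
  have hbR : b ∉ R.support := fun hb => hbp (hRp hb)
  have hR := hR'.of_sdiff_singleton hbR
  have hRP : ∀ w ∈ R.support, w ∈ P.support → w = z := fun w hw hwP =>
    (hR.mem_left_iff w hw).1 (.inr hwP)
  by_cases hzP : z ∈ P.support
  · obtain ⟨P₁, P₂, rfl⟩ := Walk.mem_support_iff_exists_append.1 hzP
    simp only [mem_support_append_iff] at hRP
    have hzb : z ≠ b := fun hzb => hbR (hzb ▸ R.start_mem_support)
    have hlen : P₁.length < n := by
      have := not_nil_iff_lt_length.1 (P₂.not_nil_of_ne hzb)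
      grind [length_append]
    obtain ⟨s, s', y, Q, Q', hQ, ha⟩ := ih _ hlen (hB.mono Set.subset_union_left)
      (hP.of_append_left hzb (C := {v | v ∈ R.support}) fun w hw hwR => hRP w hwR (.inl hw)) rfl
    obtain ⟨x, x', t, S, S', hS, hx⟩ := hQ.exists_of_fork hP.of_append_right
      (hR.mono_left (by grind) (Set.mem_insert _ _)) (fun w hw hwR => hRP w hwR (.inr hw))
    exact ⟨x, x', t, S, S', hS, by grind⟩
  · have hzA : z ∈ A := hR.start_mem.resolve_right hzP
    exact ⟨a, z, r, P, R, ⟨hP, hR.mono_left Set.subset_union_left hzA,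
      fun w hw hwR => hzP (hRP w hwR hw ▸ hw)⟩, .inl rfl⟩

end TwoConnected

section Posa

variable {V : Type*} {G : SimpleGraph V} {a u v w x y : V}

/-- Go from `a` back to `x`, jump to the first neighbour of `x` beyond `a`, and continue to `u`. -/
theorem exists_isPath_reroute {p : G.Walk x u} (hp : p.IsPath) (hxu : G.Adj x u)
    (ha : a ∈ p.support) (hau : a ≠ u) :
    ∃ q : G.Walk a u, q.IsPath ∧ (∀ z ∈ q.support, z ∈ p.support) ∧ x ∈ q.support ∧
      ∀ z ∈ p.support, G.Adj x z → z ∈ q.support := by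
  obtain ⟨p₁, p₂, rfl⟩ := Walk.mem_support_iff_exists_append.1 ha
  obtain ⟨hp₁, hp₂, hp₁₂⟩ := isPath_append_iff.1 hp
  cases p₂ with
  | nil => exact absurd rfl hau
  | @cons _ b _ hab p₂ =>
    obtain ⟨c, q, r, rfl, hxc, hq⟩ := exists_append_first p₂ (P := G.Adj x)
      ⟨u, p₂.end_mem_support, hxu⟩
    obtain ⟨hqr, haqr⟩ := (cons_isPath_iff _ _).1 hp₂
    have hr : ∀ z ∈ r.support, z ∈ (q.append r).support := fun z hz =>
      (mem_support_append_iff _ _).2 (.inr hz)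
    refine ⟨p₁.reverse.append (cons hxc r), isPath_append_iff.2 ⟨hp₁.reverse,
      (cons_isPath_iff _ _).2 ⟨hqr.of_append_right, fun hxr => ?_⟩, fun z hz hzr => ?_⟩, ?_⟩
    · exact haqr (hp₁₂ x p₁.start_mem_support (by simp [hr x hxr]) ▸ hr x hxr)
    · obtain rfl | hzr := List.mem_cons.1 (support_cons hxc r ▸ hzr)
      · rfl
      · have hza := hp₁₂ z (by simpa using hz) (by simp [hr z hzr])
        exact absurd (hza ▸ hr z hzr) haqr
    · simp only [mem_support_append_iff, support_cons, List.mem_cons, support_reverse,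
        List.mem_reverse] at hq ⊢
      grind [start_mem_support, end_mem_support]

variable [Fintype V]

theorem IsTwoConnected.exists_isCycle_of_append (h : IsTwoConnected G) {p₁ : G.Walk x u}
    {p₂ : G.Walk u w} {p₃ : G.Walk w y} (hp : (p₁.append (p₂.append p₃)).IsPath)
    (hxu : G.Adj x u) (hyw : G.Adj y w) :
    ∃ (v : V) (c : G.Walk v v), c.IsCycle ∧ x ∈ c.support ∧ y ∈ c.support ∧
      (∀ z ∈ p₁.support, G.Adj x z → z ∈ c.support) ∧
      ∀ z ∈ p₃.support, G.Adj y z → z ∈ c.support := by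
  obtain ⟨hp₁, hp₂₃, hp₁₂₃⟩ := isPath_append_iff.1 hp
  obtain ⟨hp₂, hp₃, hp₂₃'⟩ := isPath_append_iff.1 hp₂₃
  simp only [mem_support_append_iff] at hp₁₂₃
  have hP : IsPathBetween p₂ {z | z ∈ p₁.support} {z | z ∈ p₃.support} :=
    ⟨hp₂, fun z hz => ⟨fun hz₁ => hp₁₂₃ z hz₁ (.inl hz), fun h => h ▸ p₁.end_mem_support⟩,
      fun z hz => ⟨hp₂₃' z hz, fun h => h ▸ p₃.start_mem_support⟩⟩
  obtain ⟨s, s', t, Q, Q', hQ, hu⟩ := h.exists_isLinkage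
    ⟨x, p₁.start_mem_support, u, p₁.end_mem_support, hxu.ne⟩
    ⟨y, p₃.end_mem_support, w, p₃.start_mem_support, hyw.ne⟩ hP
  have hss' : s ≠ s' := fun hs => hQ.disjoint (hs ▸ Q.start_mem_support) Q'.start_mem_support
  have hwt : t ≠ w := fun ht => hQ.disjoint Q.end_mem_support (ht ▸ Q'.end_mem_support)
  have hAB : ∀ z ∈ p₁.support, z ∈ p₃.support → z = s := fun z hz hz₃ => by
    obtain rfl := hp₁₂₃ z hz (.inr hz₃)
    obtain rfl := hp₂₃' z p₂.start_mem_support hz₃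
    exact (hQ.fst.mem_left_iff z Q.end_mem_support).1 hz
  obtain ⟨α, hα, hαp, hxα, hNα⟩ : ∃ α : G.Walk s s', α.IsPath ∧
      (∀ z ∈ α.support, z ∈ p₁.support) ∧ x ∈ α.support ∧
      ∀ z ∈ p₁.support, G.Adj x z → z ∈ α.support := by
    obtain rfl | rfl := hu
    · obtain ⟨α, hα, h⟩ := exists_isPath_reroute hp₁ hxu hQ.snd.start_mem hss'.symm
      exact ⟨α.reverse, hα.reverse, by simpa using h⟩
    · exact exists_isPath_reroute hp₁ hxu hQ.fst.start_mem hss'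
  obtain ⟨β, hβ, hβp, hyβ, hNβ⟩ := exists_isPath_reroute hp₃.reverse hyw
    (by simpa using hQ.snd.end_mem) hwt
  simp only [support_reverse, List.mem_reverse] at hβp hNβ
  refine ⟨s, _, hQ.isCycle (β := β.reverse) hα hβ.reverse hαp (by simpa using hβp) hAB, ?_⟩
  simp only [mem_support_append_iff, support_reverse, List.mem_reverse]
  grind

end Posa

section PosaDegrees

theorem card_add_card_lt_of_forall_crossing {I J : Finset ℕ} {k m : ℕ} (hI : I ⊆ Icc 1 m)
    (hJ : J ⊆ range m) (hk : k ≤ m + 1) (hIJ : ∃ i ∈ J, ∃ j ∈ I, i < j)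
    (h : ∀ i ∈ J, ∀ j ∈ I, i < j → (i + 1) + (m - j + 1) < k) : #I + #J < k := by
  have hne : {e ∈ J ×ˢ I | e.1 < e.2}.Nonempty := by
    obtain ⟨i, hi, j, hj, hij⟩ := hIJ
    exact ⟨(i, j), by simp [hi, hj, hij]⟩
  -- If the crossing pair has the smallest gap, no element of `I` or `J + 1` lies in `(i + 1, j)`.
  obtain ⟨⟨i, j⟩, hij, hmin⟩ := exists_min_image _ (fun e => e.2 - e.1) hne
  simp only [mem_filter, mem_product, and_imp, Prod.forall] at hij hmin
  obtain ⟨⟨hi, hj⟩, hij⟩ := hij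
  have hgap : ∀ i' ∈ J, ∀ j' ∈ I, i' < j' → j - i ≤ j' - i' :=
    fun i' hi' j' hj' => hmin i' j' hi' hj'
  set J' := J.map (addRightEmbedding 1)
  have hdisj : Disjoint I J' := disjoint_left.2 fun a ha ha' => by
    obtain ⟨b, hb, rfl⟩ := mem_map.1 ha'
    have := h b hb (b + 1) ha (by lia)
    have := mem_Icc.1 (hI ha)
    lia
  have hsub : I ∪ J' ⊆ Icc 1 (i + 1) ∪ Icc j m := by
    intro a ha
    obtain ha | ha := mem_union.1 ha
    · have := mem_Icc.1 (hI ha)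
      have := hgap i hi a ha
      simp only [mem_union, mem_Icc]
      lia
    · obtain ⟨b, hb, rfl⟩ := mem_map.1 ha
      have := mem_range.1 (hJ hb)
      have := hgap b hb j hj
      simp only [addRightEmbedding_apply, mem_union, mem_Icc]
      lia
  calc #I + #J = #(I ∪ J') := by rw [card_union_of_disjoint hdisj, card_map]
    _ ≤ #(Icc 1 (i + 1)) + #(Icc j m) := (card_le_card hsub).trans (card_union_le _ _)
    _ = (i + 1) + (m - j + 1) := by
      have := mem_Icc.1 (hI hj)
      simp only [Nat.card_Icc]
      lia
    _ < k := h i hi j hj hij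

variable {V : Type*} {G : SimpleGraph V} {u v w x y : V} {k : ℕ}

theorem LongCycleFree.card_lt_of_forall_mem_support (h : LongCycleFree G k) {c : G.Walk v v}
    (hc : c.IsCycle) {s : Finset V} (hs : ∀ z ∈ s, z ∈ c.support) : #s < k := by
  classical
  have hsub : s ⊆ c.support.tail.toFinset := fun z hz => by
    rw [List.mem_toFinset]
    obtain rfl | hz := (mem_support_iff c).1 (hs z hz)
    · exact end_mem_tail_support hc.not_nil
    · exact hz
  calc #s ≤ #c.support.tail.toFinset := card_le_card hsub
    _ ≤ c.support.tail.length := List.toFinset_card_le _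
    _ = c.length := by simp
    _ < k := h v c hc

theorem LongCycleFree.length_lt_of_crossing (h : LongCycleFree G k) {p : G.Walk x y}
    (hp : p.IsPath) (hxy : ¬G.Adj x y) {i j : ℕ} (hij : i < j) (hj : j ≤ p.length)
    (hyi : G.Adj y (p.getVert i)) (hxj : G.Adj x (p.getVert j)) :
    (i + 1) + (p.length - j + 1) < k := by
  have hdisj : ∀ z ∈ (p.take i).support, z ∉ (p.drop j).support := by
    intro z hz hz'
    obtain ⟨a, rfl, -⟩ := mem_support_iff_exists_getVert.1 hz
    obtain ⟨b, hb, hb'⟩ := mem_support_iff_exists_getVert.1 hz'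
    rw [drop_length] at hb'
    rw [take_getVert, drop_getVert] at hb
    have := hp.getVert_injOn (show j + b ≤ p.length by lia) (show i ⊓ a ≤ p.length by lia) hb
    lia
  have hi : i ≠ 0 := by
    rintro rfl
    exact hxy (by simpa only [getVert_zero] using hyi.symm)
  have hc : (((p.take i).concat hyi.symm).append
      ((p.drop j).reverse.concat hxj.symm)).IsCycle := by
    refine isCycle_append_of_forall_mem_support ((hp.take i).concat (fun hy => ?_) _)
      ((hp.drop j).reverse.concat (fun hx => ?_) _) (fun z hz hz' => ?_) ?_
    · exact hdisj y hy (p.drop j).end_mem_support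
    · exact hdisj x (p.take i).start_mem_support (by simpa using hx)
    · simp only [support_concat, support_reverse, List.mem_append,
        List.mem_singleton, List.mem_reverse] at hz hz'
      grind
    · rw [length_concat, take_length]
      lia
  have := h _ _ hc
  simp only [length_append, length_concat, length_reverse, take_length, drop_length] at this
  lia

variable [DecidableEq V]

theorem card_filter_support_le (p : G.Walk x y) (P : V → Prop) [DecidablePred P] :
    #{z ∈ p.support.toFinset | P z} ≤ #{a ∈ range (p.length + 1) | P (p.getVert a)} := by
  refine (card_le_card fun z hz => ?_).trans (card_image_le (f := p.getVert))
  simp only [mem_filter, List.mem_toFinset, mem_support_iff_exists_getVert] at hz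
  obtain ⟨⟨a, rfl, ha⟩, hz⟩ := hz
  exact mem_image_of_mem _ (by simp [hz]; lia)

variable [DecidableRel G.Adj]

theorem LongCycleFree.card_add_card_lt_of_append [Fintype V] (h : LongCycleFree G k)
    (hG : IsTwoConnected G) {p₁ : G.Walk x u} {p₂ : G.Walk u w} {p₃ : G.Walk w y}
    (hp : (p₁.append (p₂.append p₃)).IsPath) (hxu : G.Adj x u) (hyw : G.Adj y w) :
    #{z ∈ p₁.support.toFinset | G.Adj x z} + #{z ∈ p₃.support.toFinset | G.Adj y z} < k := by
  obtain ⟨v, c, hc, hxc, hyc, hxN, hyN⟩ := hG.exists_isCycle_of_append hp hxu hyw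
  obtain ⟨-, hp₂₃, hp₁₂₃⟩ := isPath_append_iff.1 hp
  obtain ⟨-, -, hp₂₃'⟩ := isPath_append_iff.1 hp₂₃
  simp only [mem_support_append_iff] at hp₁₂₃
  set X := {z ∈ p₁.support.toFinset | G.Adj x z} with hX
  set Y := {z ∈ p₃.support.toFinset | G.Adj y z} with hY
  simp only [Finset.ext_iff, mem_filter, List.mem_toFinset] at hX hY
  have hinter : X ∩ Y ⊆ {u} := fun z hz => by
    have := hp₁₂₃ z
    grind
  have hy₁ : y ∉ p₁.support := fun hy => by
    obtain rfl := hp₁₂₃ y hy (.inr p₃.end_mem_support)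
    exact hyw.ne (hp₂₃' y p₂.start_mem_support p₃.end_mem_support)
  have hxy : x ≠ y := fun hxy => hy₁ (hxy ▸ p₁.start_mem_support)
  have hx : x ∉ X ∪ Y := by
    have := hp₁₂₃ x p₁.start_mem_support
    have := hxu.ne
    grind [SimpleGraph.irrefl]
  have hy : y ∉ X ∪ Y := by grind [SimpleGraph.irrefl]
  have hcard : #(insert x (insert y (X ∪ Y))) = #(X ∪ Y) + 2 := by
    rw [card_insert_of_notMem (by simp [hxy, hx]), card_insert_of_notMem hy]
  have := h.card_lt_of_forall_mem_support hc (s := insert x (insert y (X ∪ Y))) (by grind)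
  have := card_union_add_card_inter X Y
  have := card_le_card hinter
  simp only [card_singleton] at this
  lia

theorem LongCycleFree.card_add_card_lt_of_crossing (h : LongCycleFree G k) {p : G.Walk x y}
    (hp : p.IsPath) (hk : k ≤ p.length + 1) (hxy : ¬G.Adj x y) {i j : ℕ} (hij : i < j)
    (hj : j ≤ p.length) (hyi : G.Adj y (p.getVert i)) (hxj : G.Adj x (p.getVert j)) :
    #{z ∈ p.support.toFinset | G.Adj x z} + #{z ∈ p.support.toFinset | G.Adj y z} < k := by
  refine (add_le_add (card_filter_support_le p _) (card_filter_support_le p _)).trans_lt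
    (card_add_card_lt_of_forall_crossing (m := p.length) (fun a ha => ?_) (fun a ha => ?_) hk
      ⟨i, ?_, j, ?_, hij⟩ fun a ha b hb hab => ?_)
  · obtain rfl | ha₀ := eq_or_ne a 0
    · simp at ha
    · simp only [mem_filter, mem_range, mem_Icc] at ha ⊢
      lia
  · obtain rfl | ha₀ := eq_or_ne a p.length
    · simp at ha
    · simp only [mem_filter, mem_range] at ha ⊢
      lia
  · simp only [mem_filter, mem_range]
    exact ⟨by lia, hyi⟩
  · simp only [mem_filter, mem_range]
    exact ⟨by lia, hxj⟩
  · simp only [mem_filter, mem_range] at ha hb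
    exact h.length_lt_of_crossing hp hxy hab (by lia) ha.2 hb.2

theorem LongCycleFree.card_add_card_lt [Fintype V] (h : LongCycleFree G k)
    (hG : IsTwoConnected G) {p : G.Walk x y} (hp : p.IsPath) (hk : k ≤ p.length + 1)
    (hne : x ≠ y) (hxy : ¬G.Adj x y) :
    #{z ∈ p.support.toFinset | G.Adj x z} + #{z ∈ p.support.toFinset | G.Adj y z} < k := by
  have hnil : ¬p.Nil := not_nil_of_ne hne
  obtain ⟨u, p₁, q, rfl, hxu, hu⟩ := exists_append_last p (P := G.Adj x)
    ⟨p.snd, p.getVert_mem_support 1, p.adj_snd hnil⟩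
  have hq : ¬q.Nil := not_nil_of_ne fun huy => hxy (huy ▸ hxu)
  obtain ⟨w, p₂, p₃, rfl, hyw, hw⟩ := exists_append_first q (P := G.Adj y)
    ⟨q.penultimate, q.getVert_mem_support _, (q.adj_penultimate hq).symm⟩
  by_cases hcross : ∃ z ∈ p₁.support, z ≠ u ∧ G.Adj y z
  · obtain ⟨z, hz, hzu, hyz⟩ := hcross
    obtain ⟨i, rfl, hi⟩ := mem_support_iff_exists_getVert.1 hz
    have hi : i < p₁.length := hi.lt_of_ne fun hi => hzu (hi ▸ p₁.getVert_length)
    refine h.card_add_card_lt_of_crossing hp hk hxy hi (by simp) ?_ ?_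
    · rwa [getVert_append, if_pos hi]
    · rwa [getVert_append, if_neg (lt_irrefl _), Nat.sub_self, getVert_zero]
  · refine lt_of_le_of_lt (add_le_add (card_le_card fun z hz => ?_) (card_le_card fun z hz => ?_))
      (h.card_add_card_lt_of_append hG hp hxu hyw)
    all_goals
      simp only [mem_filter, List.mem_toFinset, mem_support_append_iff] at hz hu hw ⊢
      grind [start_mem_support, end_mem_support]

end PosaDegrees

section Saturation

variable {V : Type*} {G : SimpleGraph V} {x y : V} {k : ℕ}

theorem exists_isPath_of_isCycle_of_mem_edges {v : V} {c : G.Walk v v} (hc : c.IsCycle)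
    (hxy : s(x, y) ∈ c.edges) :
    ∃ p : G.Walk x y, p.IsPath ∧ s(x, y) ∉ p.edges ∧ p.length + 1 = c.length := by
  classical
  have hx : x ∈ c.support := c.fst_mem_support_of_mem_edges hxy
  obtain ⟨c', hc', hlen, rfl⟩ : ∃ c' : G.Walk x x, c'.IsCycle ∧ c'.length = c.length ∧
      c'.snd = y := by
    have hy : y ∈ (c.rotate x hx).toSubgraph.neighborSet x := by
      rwa [Subgraph.mem_neighborSet, toSubgraph_rotate, adj_toSubgraph_iff_mem_edges]
    rw [(hc.rotate hx).neighborSet_toSubgraph_endpoint] at hy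
    obtain rfl | rfl := hy
    · exact ⟨_, hc.rotate hx, by simp, rfl⟩
    · exact ⟨_, (hc.rotate hx).reverse, by simp, by simp⟩
  have hsnd := (cons_isCycle_iff _ _).1 ((c'.cons_tail_eq hc'.not_nil).symm ▸ hc')
  exact ⟨c'.tail.reverse, hsnd.1.reverse, by simpa using hsnd.2,
    by rw [length_reverse, length_tail_add_one hc'.not_nil, hlen]⟩

theorem LongCycleFree.not_adj_of_isPath (h : LongCycleFree G k) {p : G.Walk x y} (hp : p.IsPath)
    (hlen : 1 < p.length) (hk : k ≤ p.length + 1) : ¬G.Adj x y := fun hxy => by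
  have := h x (p.append hxy.symm.toWalk) <| isCycle_append_of_forall_mem_support hp
    (IsPath.of_adj _) (fun z _ hz => by simpa [or_comm] using hz) hlen
  rw [length_append, Adj.length_toWalk] at this
  lia

theorem exists_isPath_of_maximal_longCycleFree (h : Maximal (LongCycleFree · k) G)
    (hne : x ≠ y) (hxy : ¬G.Adj x y) : ∃ p : G.Walk x y, p.IsPath ∧ k ≤ p.length + 1 := by
  have hedge : (edge x y).Adj x y := by simp [edge_adj, hne]
  have hnew : ¬LongCycleFree (G ⊔ edge x y) k := fun hH => hxy (h.2 hH le_sup_left (.inr hedge))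
  simp only [LongCycleFree, not_forall, not_lt] at hnew
  obtain ⟨v, c, hc, hk⟩ := hnew
  have hG : ∀ e ∈ (G ⊔ edge x y).edgeSet, e ≠ s(x, y) → e ∈ G.edgeSet := by
    rintro ⟨a, b⟩ hab hne
    obtain hab | hab := hab
    · exact hab
    · exact absurd ((edge_adj ..).1 hab) (by grind)
  by_cases hmem : s(x, y) ∈ c.edges
  · obtain ⟨p, hp, hpe, hpc⟩ := exists_isPath_of_isCycle_of_mem_edges hc hmem
    have hpG : ∀ e ∈ p.edges, e ∈ G.edgeSet := fun e he =>
      hG e (p.edges_subset_edgeSet he) fun h => hpe (h ▸ he)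
    exact ⟨p.transfer G hpG, hp.transfer hpG, by rw [length_transfer]; lia⟩
  · have hcG : ∀ e ∈ c.edges, e ∈ G.edgeSet := fun e he =>
      hG e (c.edges_subset_edgeSet he) fun h => hmem (h ▸ he)
    have := h.1 v (c.transfer G hcG) (hc.transfer hcG)
    rw [length_transfer] at this
    lia

variable [Fintype V] [DecidableRel G.Adj]

/-- The subgraph induced on `S` has minimum degree at least `d`; this is vacuous for `S = ∅`. -/
def MinDegreeOn (G : SimpleGraph V) [DecidableRel G.Adj] (d : ℕ) (S : Finset V) : Prop :=
  ∀ v ∈ S, d ≤ #{w ∈ S | G.Adj v w}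

theorem LongCycleFree.length_add_one_lt_of_minDegreeOn (h : LongCycleFree G k)
    (hG : IsTwoConnected G) (hk : 3 ≤ k) {S T : Finset V} {α β : ℕ} (hS : MinDegreeOn G α S)
    (hT : MinDegreeOn G β T) (hαβ : k ≤ α + β) (hx : x ∈ S) (hy : y ∈ T) {p : G.Walk x y}
    (hp : p.IsPath) : p.length + 1 < k := by
  classical
  induction hm : Fintype.card V - p.length using Nat.strong_induction_on generalizing x y with
  | _ m ih
  by_contra! hpk
  have hcard := hp.length_lt
  have hxS : ∀ z ∈ S, G.Adj x z → z ∈ p.support := fun z hz hxz => by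
    by_contra hzp
    have := ih _ (by rw [length_cons]; lia) hz hy (hp.cons hzp (h := hxz.symm)) rfl
    rw [length_cons] at this
    lia
  have hyT : ∀ z ∈ T, G.Adj y z → z ∈ p.support := fun z hz hyz => by
    by_contra hzp
    have := ih _ (by rw [length_concat]; lia) hx hz (hp.concat hzp hyz) rfl
    rw [length_concat] at this
    lia
  have hne : x ≠ y := by
    rintro rfl
    have := length_eq_zero_iff.2 (isPath_iff_nil.1 hp)
    lia
  have hxy : ¬G.Adj x y := h.not_adj_of_isPath hp (by lia) hpk
  have hxcard : #{z ∈ S | G.Adj x z} ≤ #{z ∈ p.support.toFinset | G.Adj x z} :=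
    card_le_card fun z hz => by
      simp only [mem_filter, List.mem_toFinset] at hz ⊢
      exact ⟨hxS z hz.1 hz.2, hz.2⟩
  have hycard : #{z ∈ T | G.Adj y z} ≤ #{z ∈ p.support.toFinset | G.Adj y z} :=
    card_le_card fun z hz => by
      simp only [mem_filter, List.mem_toFinset] at hz ⊢
      exact ⟨hyT z hz.1 hz.2, hz.2⟩
  have := h.card_add_card_lt hG hp hpk hne hxy
  have := hS x hx
  have := hT y hy
  lia

theorem adj_of_maximal_longCycleFree (h : Maximal (LongCycleFree · k) G)
    (hG : IsTwoConnected G) (hk : 3 ≤ k) {S T : Finset V} {α β : ℕ} (hS : MinDegreeOn G α S)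
    (hT : MinDegreeOn G β T) (hαβ : k ≤ α + β) (hx : x ∈ S) (hy : y ∈ T) (hne : x ≠ y) :
    G.Adj x y := by
  by_contra hxy
  obtain ⟨p, hp, hpk⟩ := exists_isPath_of_maximal_longCycleFree h hne hxy
  exact hpk.not_gt (h.1.length_add_one_lt_of_minDegreeOn hG hk hS hT hαβ hx hy hp)

end Saturation

section Disintegration

theorem LongCycleFree.card_lt_of_isClique {V : Type*} {G : SimpleGraph V} {k : ℕ}
    (h : LongCycleFree G k) {s : Finset V} (hs : G.IsClique s) (hcard : 3 ≤ #s) : #s < k := by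
  obtain ⟨v, c, hc, hlen⟩ := (cycleGraph_isContained_iff (G := G) (n := #s) hcard).1 <|
    isContained_iff_exists_le_comap.2
      ⟨s.equivFin.symm.toEmbedding.trans (Function.Embedding.subtype (· ∈ s)), fun a b hab =>
        hs (s.equivFin.symm a).2 (s.equivFin.symm b).2
          (Subtype.val_injective.ne (s.equivFin.symm.injective.ne hab.ne))⟩
  exact hlen ▸ h v c hc

variable {V : Type*} [Fintype V] {G G' : SimpleGraph V} [DecidableRel G.Adj]
  [DecidableRel G'.Adj] {d k m r : ℕ} {S U : Finset V}

theorem IsTwoConnected.minDegreeOn_univ (h : IsTwoConnected G) : MinDegreeOn G 2 univ := by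
  classical
  intro v _
  have : Nontrivial V := Fintype.one_lt_card_iff_nontrivial.1 (by have := h.1; lia)
  obtain ⟨w, hvw⟩ := h.2.1.preconnected.exists_adj_of_nontrivial v
  obtain ⟨u, hu⟩ : ∃ u, u ∉ ({v, w} : Finset V) := by
    by_contra! hall
    have := card_le_card fun x (_ : x ∈ univ) => hall x
    have := h.1
    have := card_le_two (a := v) (b := w)
    rw [card_univ] at *
    lia
  simp only [mem_insert, mem_singleton, not_or] at hu
  obtain ⟨p, -, hp⟩ := h.exists_isPath_notMem_support hvw.ne hu.2
  have hsnd := p.adj_snd (not_nil_of_ne (Ne.symm hu.1))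
  exact one_lt_card.2 ⟨w, by simpa using hvw, p.snd, by simpa using hsnd,
    fun hw => hp (hw ▸ p.getVert_mem_support 1)⟩

open Classical in
/-- The `d`-core of `G`, i.e. the largest vertex set inducing a subgraph of minimum degree at
least `d`. -/
noncomputable def core (G : SimpleGraph V) [DecidableRel G.Adj] (d : ℕ) : Finset V :=
  {v | ∃ S, MinDegreeOn G d S ∧ v ∈ S}

theorem MinDegreeOn.subset_core (hS : MinDegreeOn G d S) : S ⊆ core G d := fun v hv => by
  simpa [core] using ⟨S, hS, hv⟩

theorem minDegreeOn_core (G : SimpleGraph V) [DecidableRel G.Adj] (d : ℕ) :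
    MinDegreeOn G d (core G d) := fun v hv => by
  obtain ⟨S, hS, hvS⟩ : ∃ S, MinDegreeOn G d S ∧ v ∈ S := by simpa [core] using hv
  exact (hS v hvS).trans (card_le_card (filter_subset_filter _ hS.subset_core))

theorem card_edgeFinset_inter_sym2_le_extremalNumber [DecidableEq V] (h : G.CliqueFree r)
    (U : Finset V) :
    #(G.edgeFinset ∩ U.sym2) ≤ extremalNumber #U (⊤ : SimpleGraph (Fin r)) := by
  have hfree : (⊤ : SimpleGraph (Fin r)).Free (G.induce (U : Set V)) := by
    have := cliqueFree_iff_top_free (G := G.induce (U : Set V)) (β := Fin r)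
    rw [Fintype.card_fin] at this
    exact this.1 (h.comap (Embedding.induce (U : Set V)).isContained)
  rw [← filter_edgeFinset_toFinset_subset, card_filter_edgeFinset_toFinset_subset]
  exact (card_edgeFinset_le_extremalNumber hfree).trans_eq (by simp)

theorem card_edgeFinset_inter_sym2_le_erase [DecidableEq V] (U : Finset V) (v : V) :
    #(G.edgeFinset ∩ U.sym2) ≤
      #(G.edgeFinset ∩ (U.erase v).sym2) + #{w ∈ U | G.Adj v w} := by
  have hsub : G.edgeFinset ∩ U.sym2 ⊆ G.edgeFinset ∩ (U.erase v).sym2 ∪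
      {w ∈ U | G.Adj v w}.image (s(v, ·)) := by
    intro e
    induction e with | _ a b
    simp only [mem_inter, mem_edgeFinset, SimpleGraph.mem_edgeSet, mk_mem_sym2_iff, mem_union,
      mem_image, mem_filter, mem_erase, Sym2.eq_iff]
    grind [SimpleGraph.adj_comm]
  calc _ ≤ _ := card_le_card hsub
    _ ≤ _ := card_union_le _ _
    _ ≤ _ := Nat.add_le_add_left card_image_le _

theorem exists_card_eq_of_core_subset [DecidableEq V] (hle : G ≤ G') (hU : core G' (d + 1) ⊆ U)
    (hm : #(core G' (d + 1)) ≤ m) (hmU : m ≤ #U) :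
    ∃ T, #T = m ∧ #(G.edgeFinset ∩ U.sym2) ≤ d * (#U - m) + #(G.edgeFinset ∩ T.sym2) := by
  induction hn : #U - m generalizing U with
  | zero => exact ⟨U, by lia, by simp⟩
  | succ n ih =>
    obtain ⟨v, hv, hvd⟩ : ∃ v ∈ U, #{w ∈ U | G'.Adj v w} < d + 1 := by
      by_contra! hall
      have := card_le_card (MinDegreeOn.subset_core hall)
      lia
    have hvcore : v ∉ core G' (d + 1) := fun hvc =>
      ((minDegreeOn_core G' (d + 1) v hvc).trans
        (card_le_card (filter_subset_filter _ hU))).not_gt hvd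
    have hcard : #(U.erase v) = #U - 1 := card_erase_of_mem hv
    obtain ⟨T, hT, hle'⟩ := ih (U := U.erase v) (subset_erase.2 ⟨hU, hvcore⟩) (by lia) (by lia)
    refine ⟨T, hT, ?_⟩
    have hdeg : #{w ∈ U | G.Adj v w} ≤ #{w ∈ U | G'.Adj v w} :=
      card_le_card (monotone_filter_right _ fun w _ hw => hle hw)
    have := card_edgeFinset_inter_sym2_le_erase (G := G) U v
    rw [Nat.mul_succ]
    lia

theorem card_edgeFinset_le_gTuran_of_card_core_le (hle : G ≤ G') (hr : G.CliqueFree r) {a : ℕ}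
    (hak : a ≤ k) (hk : k ≤ Fintype.card V) (hcore : #(core G' (a + 1)) ≤ k - a) :
    #G.edgeFinset ≤ gTuran r (Fintype.card V) a k := by
  classical
  obtain ⟨T, hT, hGT⟩ := exists_card_eq_of_core_subset hle (subset_univ _) hcore
    (by rw [card_univ]; lia)
  calc #G.edgeFinset = #(G.edgeFinset ∩ univ.sym2) := by simp
    _ ≤ a * (#univ - (k - a)) + #(G.edgeFinset ∩ T.sym2) := hGT
    _ ≤ a * (Fintype.card V - k + a) + extremalNumber (k - a) ⊤ := by
      rw [card_univ, show Fintype.card V - (k - a) = Fintype.card V - k + a by lia, ← hT]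
      gcongr
      exact card_edgeFinset_inter_sym2_le_extremalNumber hr T

end Disintegration

section UpperBound

variable {V : Type*} {G : SimpleGraph V} [DecidableRel G.Adj] {d k r : ℕ} {S : Finset V}

theorem MinDegreeOn.mono {d' : ℕ} (hS : MinDegreeOn G d S) (hd : d' ≤ d) : MinDegreeOn G d' S :=
  fun v hv => hd.trans (hS v hv)

theorem MinDegreeOn.lt_card (hS : MinDegreeOn G d S) (hne : S.Nonempty) : d < #S := by
  obtain ⟨v, hv⟩ := hne
  exact (hS v hv).trans_lt (card_lt_card (filter_ssubset.2 ⟨v, hv, G.irrefl⟩))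

theorem minDegreeOn_of_isClique (hS : G.IsClique S) : MinDegreeOn G (#S - 1) S := fun v hv => by
  classical
  rw [← card_erase_of_mem hv]
  refine card_le_card fun w hw => ?_
  rw [mem_erase] at hw
  exact mem_filter.2 ⟨hw.2, hS hv hw.2 hw.1.symm⟩

variable [Fintype V]

theorem isClique_core_of_maximal_longCycleFree (h : Maximal (LongCycleFree · k) G)
    (hG : IsTwoConnected G) (hk : 3 ≤ k) (hd : k ≤ d + d) : G.IsClique (core G d) :=
  fun _ hx _ hy hne =>
    adj_of_maximal_longCycleFree h hG hk (minDegreeOn_core G d) (minDegreeOn_core G d) hd hx hy hne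

theorem core_eq_core_of_maximal_longCycleFree (h : Maximal (LongCycleFree · k) G)
    (hG : IsTwoConnected G) (hk : 3 ≤ k) (hd : k ≤ d + d) (hne : (core G d).Nonempty) :
    core G (k + 1 - #(core G d)) = core G d := by
  classical
  have hK := isClique_core_of_maximal_longCycleFree h hG hk hd
  have hcard := (minDegreeOn_core G d).lt_card hne
  refine subset_antisymm (fun y hy => ?_)
    ((minDegreeOn_core G d).mono (by lia)).subset_core
  by_contra hyK
  have hadj : ∀ x ∈ core G d, y ≠ x → G.Adj y x := fun x hx hyx =>
    (adj_of_maximal_longCycleFree h hG hk (minDegreeOn_of_isClique hK) (minDegreeOn_core G _)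
      (by lia) hx hy hyx.symm).symm
  have hins := minDegreeOn_of_isClique (S := insert y (core G d)) (by
    rw [coe_insert]
    exact hK.insert hadj)
  rw [card_insert_of_notMem hyK] at hins
  exact hyK ((hins.mono (by lia)).subset_core (mem_insert_self _ _))

theorem card_core_add_two_le_of_maximal_longCycleFree (h : Maximal (LongCycleFree · k) G)
    (hG : IsTwoConnected G) (hk : 3 ≤ k) (hkV : k ≤ Fintype.card V) (hd : k ≤ d + d)
    (hne : (core G d).Nonempty) : #(core G d) + 2 ≤ k := by
  by_contra! hlt
  have huniv : core G d = univ := univ_subset_iff.1 <|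
    (hG.minDegreeOn_univ.mono (by lia)).subset_core.trans_eq
      (core_eq_core_of_maximal_longCycleFree h hG hk hd hne)
  have hlt := h.1.card_lt_of_isClique (isClique_core_of_maximal_longCycleFree h hG hk hd)
  rw [huniv, card_univ] at hlt
  exact (hlt (hk.trans hkV)).not_ge hkV

theorem exists_card_edgeFinset_le_gTuran (hk : 5 ≤ k) (hkV : k ≤ Fintype.card V)
    (hG : IsTwoConnected G) (hr : G.CliqueFree r) (hcyc : LongCycleFree G k) :
    ∃ a, 2 ≤ a ∧ a ≤ (k - 1) / 2 ∧ #G.edgeFinset ≤ gTuran r (Fintype.card V) a k := by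
  classical
  obtain ⟨H, hGH, hmax⟩ := Finite.exists_le_maximal (p := (LongCycleFree · k)) hcyc
  have hH := hG.mono hGH
  set K := core H ((k - 1) / 2 + 1) with hKdef
  obtain hK | hK := K.eq_empty_or_nonempty
  · exact ⟨(k - 1) / 2, by lia, le_rfl,
      card_edgeFinset_le_gTuran_of_card_core_le hGH hr (by lia) hkV (by simp [← hKdef, hK])⟩
  · have hlt : (k - 1) / 2 + 1 < #K := (minDegreeOn_core H _).lt_card hK
    have hle : #K + 2 ≤ k :=
      card_core_add_two_le_of_maximal_longCycleFree hmax hH (by lia) hkV (by lia) hK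
    refine ⟨k - #K, by lia, by lia,
      card_edgeFinset_le_gTuran_of_card_core_le hGH hr (by lia) hkV ?_⟩
    rw [show k - #K + 1 = k + 1 - #K by lia,
      core_eq_core_of_maximal_longCycleFree hmax hH (by lia) (by lia) hK]
    lia

end UpperBound

section Convexity

theorem card_edgeFinset_turanGraph_eq_choose {m p : ℕ} (h : p = 0 ∨ m ≤ p) :
    #(turanGraph m p).edgeFinset = m.choose 2 := by
  have := card_edgeFinset_top_eq_card_choose_two (V := Fin m)
  rw [Fintype.card_fin] at this
  rw [← this, edgeFinset_inj.2 (turanGraph_eq_top.2 h)]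

theorem card_edgeFinset_turanGraph_succ (m p : ℕ) :
    #(turanGraph (m + 1) p).edgeFinset = #(turanGraph m p).edgeFinset + (m - m / p) := by
  induction m using Nat.strong_induction_on with
  | _ m ih
  by_cases h : p = 0 ∨ m + 1 ≤ p
  · have hdiv : m / p = 0 := Nat.div_eq_zero_iff.2 (by lia)
    rw [card_edgeFinset_turanGraph_eq_choose h, card_edgeFinset_turanGraph_eq_choose (by lia),
      Nat.choose_succ_succ' m 1, Nat.choose_one_right, hdiv, Nat.sub_zero, add_comm]
  · obtain ⟨j, rfl⟩ := Nat.exists_eq_add_of_le' (show p ≤ m by lia)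
    have := ih j (by lia)
    have := Nat.div_le_self j p
    rw [add_right_comm, card_edgeFinset_turanGraph_add, card_edgeFinset_turanGraph_add,
      Nat.add_div_right _ (by lia), Nat.add_one_mul]
    lia

theorem two_mul_card_edgeFinset_turanGraph_succ_le (m p : ℕ) :
    2 * #(turanGraph (m + 1) p).edgeFinset ≤
      #(turanGraph m p).edgeFinset + #(turanGraph (m + 2) p).edgeFinset := by
  have := Nat.succ_div (a := m) (b := p)
  rw [card_edgeFinset_turanGraph_succ (m + 1), card_edgeFinset_turanGraph_succ m]
  split_ifs at this <;> lia

theorem two_mul_extremalNumber_top_succ_le (W : Type*) [Finite W] [Nontrivial W] (m : ℕ) :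
    2 * extremalNumber (m + 1) (⊤ : SimpleGraph W) ≤
      extremalNumber m (⊤ : SimpleGraph W) + extremalNumber (m + 2) (⊤ : SimpleGraph W) := by
  have := Fintype.ofFinite W
  simpa only [extremalNumber_top] using two_mul_card_edgeFinset_turanGraph_succ_le m _

theorem le_max_of_forall_lt_imp_lt {α : Type*} [LinearOrder α] {f : ℕ → α} {l u x : ℕ}
    (h : ∀ a, l ≤ a → a + 2 ≤ u → f (a + 2) < f (a + 1) → f (a + 1) < f a) (hlx : l ≤ x)
    (hxu : x ≤ u) : f x ≤ max (f l) (f u) := by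
  induction u, hlx.trans hxu using Nat.le_induction generalizing x with
  | base => exact le_max_of_le_left (by rw [le_antisymm hxu hlx])
  | succ u hlu ih =>
    replace ih := fun {x} => ih (x := x) fun a hla hau => h a hla (by lia)
    obtain rfl | hxu := hxu.eq_or_lt
    · exact le_max_right _ _
    suffices hu : f u ≤ max (f l) (f (u + 1)) from
      (ih hlx (by lia)).trans (max_le (le_max_left _ _) hu)
    obtain rfl | hlu := hlu.eq_or_lt
    · exact le_max_left _ _
    obtain ⟨a, rfl⟩ := Nat.exists_eq_add_of_lt hlu
    by_contra! hlt
    rw [max_lt_iff] at hlt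
    have ha : f (l + a + 1) < f (l + a) := h (l + a) (by lia) le_rfl hlt.2
    exact (ih (by lia : l ≤ l + a) (by lia)).not_gt (max_lt (hlt.1.trans ha) ha)

theorem gTuran_le_max {n k r a : ℕ} (hr : 2 ≤ r) (ha : 2 ≤ a) (hak : a ≤ (k - 1) / 2) :
    gTuran r n a k ≤ max (gTuran r n 2 k) (gTuran r n ((k - 1) / 2) k) := by
  have : Nontrivial (Fin r) := Fin.nontrivial_iff_two_le.2 hr
  refine le_max_of_forall_lt_imp_lt (f := (gTuran r n · k)) (fun b _ hb hlt => ?_) ha hak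
  have hconv := two_mul_extremalNumber_top_succ_le (Fin r) (k - (b + 2))
  rw [show k - (b + 2) + 1 = k - (b + 1) by lia, show k - (b + 2) + 2 = k - b by lia] at hconv
  simp only [gTuran] at hlt ⊢
  nlinarith

end Convexity

section Covering

variable {V : Type*} {G : SimpleGraph V} {A C : Finset V}

theorem exists_isPath_of_isCycle {v : V} {c : G.Walk v v} (hc : c.IsCycle) :
    ∃ w, ∃ p : G.Walk v w, p.IsPath ∧ p.length + 1 = c.length ∧ p.support ⊆ c.support :=
  ⟨_, c.tail.reverse, hc.isPath_tail.reverse, by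
    rw [length_reverse, length_tail_add_one hc.not_nil], fun x hx => by
    rw [support_reverse, List.mem_reverse, support_tail_of_not_nil _ hc.not_nil] at hx
    exact List.mem_of_mem_tail hx⟩

theorem countP_mem_le_card [DecidableEq V] {l : List V} (hl : l.Nodup) (s : Finset V) :
    l.countP (· ∈ s) ≤ #s := by
  rw [List.countP_eq_length_filter, ← List.toFinset_card_of_nodup (hl.filter _)]
  exact card_le_card fun x hx => by simpa using (List.mem_filter.1 (List.mem_toFinset.1 hx)).2

theorem length_add_one_add_min_le_countP [DecidableEq V]
    (h : ∀ x y, G.Adj x y → x ∈ A ∨ y ∈ A ∨ x ∈ C ∧ y ∈ C) {u v : V} (p : G.Walk u v) :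
    p.length + 1 + min 1 (p.support.countP (· ∈ C)) ≤
      2 * p.support.countP (· ∈ A) + p.support.countP (· ∈ C) + (if u ∈ A then 0 else 1) := by
  induction p with
  | nil =>
    simp only [support_nil, List.countP_cons, List.countP_nil, length_nil, decide_eq_true_eq]
    split_ifs <;> lia
  | @cons u w _ huw q ih =>
    have hw : w ∈ C → 0 < q.support.countP (· ∈ C) := fun hw =>
      List.countP_pos_iff.2 ⟨w, q.start_mem_support, by simpa using hw⟩
    have := h u w huw
    simp only [support_cons, List.countP_cons, length_cons, decide_eq_true_eq]
    split_ifs at ih ⊢ <;> grind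

theorem longCycleFree_of_forall_adj (hA : A.Nonempty) (hC : C.Nonempty)
    (h : ∀ x y, G.Adj x y → x ∈ A ∨ y ∈ A ∨ x ∈ C ∧ y ∈ C) :
    LongCycleFree G (2 * #A + #C) := by
  classical
  intro v c hc
  have := hA.card_pos
  have := hC.card_pos
  by_cases hcA : ∃ u ∈ c.support, u ∈ A
  · obtain ⟨u, hu, huA⟩ := hcA
    obtain ⟨w, p, hp, hlen, -⟩ := exists_isPath_of_isCycle (hc.rotate hu)
    have hle := length_add_one_add_min_le_countP h p
    have := countP_mem_le_card hp.support_nodup A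
    have := countP_mem_le_card hp.support_nodup C
    rw [length_rotate] at hlen
    rw [if_pos huA] at hle
    lia
  · obtain ⟨w, p, hp, hlen, hsub⟩ := exists_isPath_of_isCycle hc
    have hle := length_add_one_add_min_le_countP h p
    have hpA : p.support.countP (· ∈ A) = 0 :=
      List.countP_eq_zero.2 fun z hz hzA => hcA ⟨z, hsub hz, of_decide_eq_true hzA⟩
    have := countP_mem_le_card hp.support_nodup C
    have := hc.three_le_length
    split_ifs at hle <;> lia

end Covering

section Clique

variable {V : Type*} {G : SimpleGraph V} {S : Set V}

theorem connected_of_isClique (hS : G.IsClique S) (hne : S.Nonempty)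
    (h : ∀ x ∉ S, ∃ y ∈ S, G.Adj x y) : G.Connected := by
  have hreach : ∀ x ∈ S, ∀ y ∈ S, G.Reachable x y := fun x hx y hy => by
    obtain rfl | hxy := eq_or_ne x y
    · rfl
    · exact (hS hx hy hxy).reachable
  have hhub : ∀ x, ∃ y ∈ S, G.Reachable x y := fun x => by
    by_cases hx : x ∈ S
    · exact ⟨x, hx, .rfl⟩
    · obtain ⟨y, hy, hxy⟩ := h x hx
      exact ⟨y, hy, hxy.reachable⟩
  refine connected_iff _ |>.2 ⟨fun x y => ?_, hne.to_type⟩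
  obtain ⟨s, hs, hxs⟩ := hhub x
  obtain ⟨t, ht, hyt⟩ := hhub y
  exact hxs.trans ((hreach s hs t ht).trans hyt.symm)

theorem isTwoConnected_of_isClique [Fintype V] (hV : 3 ≤ Fintype.card V) (hS : G.IsClique S)
    (hS' : S.Nontrivial) (h : ∀ x ∉ S, (G.neighborSet x ∩ S).Nontrivial) : IsTwoConnected G := by
  refine ⟨hV, connected_of_isClique hS hS'.nonempty fun x hx => ?_, fun v =>
    connected_of_isClique (S := Subtype.val ⁻¹' S) (fun x hx y hy hxy =>
      hS hx hy (Subtype.val_injective.ne hxy)) ?_ fun x hx => ?_⟩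
  · obtain ⟨y, hxy, hy⟩ := (h x hx).nonempty
    exact ⟨y, hy, hxy⟩
  · obtain ⟨s, hs, hsv⟩ := hS'.exists_ne v
    exact ⟨⟨s, hsv⟩, hs⟩
  · obtain ⟨y, ⟨hxy, hy⟩, hyv⟩ := (h x hx).exists_ne v
    exact ⟨⟨y, hyv⟩, hy, hxy⟩

end Clique

section Construction

/-- The graph on `n` vertices attaining `gTuran r n a k` for `m = k - a` and `p = r - 1`: the Turán
graph with `p` parts on the first `m` vertices, together with all edges from the first `a` vertices
to the last `n - m` ones. -/
def turanKopylov (n m a p : ℕ) : SimpleGraph (Fin n) :=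
  .fromRel fun i j => (i.val < m ∧ j.val < m ∧ i.val % p ≠ j.val % p) ∨ (i.val < a ∧ m ≤ j.val)

variable {n m a p : ℕ}

theorem turanKopylov_adj {i j : Fin n} : (turanKopylov n m a p).Adj i j ↔ i ≠ j ∧
    (((i.val < m ∧ j.val < m ∧ i.val % p ≠ j.val % p) ∨ (i.val < a ∧ m ≤ j.val)) ∨
      ((j.val < m ∧ i.val < m ∧ j.val % p ≠ i.val % p) ∨ (j.val < a ∧ m ≤ i.val))) :=
  fromRel_adj ..

theorem turanKopylov_cliqueFree (hap : a < p) (ham : a ≤ m) :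
    (turanKopylov n m a p).CliqueFree (p + 1) := by
  refine Colorable.cliqueFree ⟨Coloring.mk (fun i => if i.val < m then
    (⟨i.val % p, Nat.mod_lt _ (by lia)⟩ : Fin p) else ⟨p - 1, by lia⟩) fun {i j} hij => ?_⟩
    p.lt_add_one
  have (l : ℕ) (hl : l < a) : l % p = l := Nat.mod_eq_of_lt (by lia)
  rw [turanKopylov_adj] at hij
  split_ifs <;> grind

theorem turanKopylov_longCycleFree (ha : 0 < a) (ham : a < m) (hmn : m ≤ n) :
    LongCycleFree (turanKopylov n m a p) (m + a) := by
  let A : Finset (Fin n) := (range a).attachFin fun i hi => by grind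
  let C : Finset (Fin n) := (Ico a m).attachFin fun i hi => by grind
  have hA : #A = a := by rw [card_attachFin, card_range]
  have hC : #C = m - a := by rw [card_attachFin, Nat.card_Ico]
  rw [show m + a = 2 * #A + #C by lia]
  refine longCycleFree_of_forall_adj (card_pos.1 (by lia)) (card_pos.1 (by lia)) fun i j hij => ?_
  rw [turanKopylov_adj] at hij
  simp only [A, C, mem_attachFin, mem_range, mem_Ico]
  lia

theorem turanKopylov_isTwoConnected (ha : 2 ≤ a) (ham : a < m) (hmn : m ≤ n) (hp : 3 ≤ p) :
    IsTwoConnected (turanKopylov n m a p) := by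
  have hmod (l : ℕ) (hl : l < 3) : l % p = l := Nat.mod_eq_of_lt (by lia)
  refine isTwoConnected_of_isClique (S := {i | i.val < 3}) (by rw [Fintype.card_fin]; lia)
    (fun i hi j hj hij => turanKopylov_adj.2 ⟨hij, .inl (.inl ?_)⟩)
    ⟨⟨0, by lia⟩, by simp, ⟨1, by lia⟩, by simp, by simp⟩ fun x hx => ?_
  · rw [Set.mem_ofPred_eq] at hi hj
    exact ⟨by lia, by lia, by rwa [hmod _ hi, hmod _ hj, Fin.val_ne_iff]⟩
  · rw [Set.mem_ofPred_eq, not_lt] at hx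
    have hadj (i : ℕ) (hi : i < 3) (hxi : x.val < m ∧ x.val % p ≠ i ∨ m ≤ x.val ∧ i < 2) :
        ⟨i, by lia⟩ ∈ (turanKopylov n m a p).neighborSet x ∩ {j | j.val < 3} := by
      refine ⟨turanKopylov_adj.2 ⟨by grind, ?_⟩, hi⟩
      rw [hmod i hi]
      lia
    by_cases h0 : x.val < m ∧ x.val % p = 0
    · exact ⟨_, hadj 1 (by lia) (by lia), _, hadj 2 (by lia) (by lia), by simp⟩
    by_cases h1 : x.val < m ∧ x.val % p = 1
    · exact ⟨_, hadj 0 (by lia) (by lia), _, hadj 2 (by lia) (by lia), by simp⟩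
    · exact ⟨_, hadj 0 (by lia) (by lia), _, hadj 1 (by lia) (by lia), by simp⟩

theorem le_ncard_edgeSet_turanKopylov (ham : a ≤ m) (hmn : m ≤ n) :
    a * (n - m) + #(turanGraph m p).edgeFinset ≤ (turanKopylov n m a p).edgeSet.ncard := by
  let T : Set (Sym2 (Fin n)) := Sym2.map (Fin.castLE hmn) '' (turanGraph m p).edgeSet
  let B : Set (Sym2 (Fin n)) := Set.range fun x : Fin a × Fin (n - m) =>
    s(⟨x.1, by lia⟩, ⟨m + x.2, by lia⟩)
  have hT : T.ncard = #(turanGraph m p).edgeFinset := by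
    rw [Set.ncard_image_of_injective _ (Sym2.map.injective (Fin.castLE_injective hmn)),
      ← coe_edgeFinset, Set.ncard_coe_finset]
  have hB : B.ncard = a * (n - m) := by
    rw [Set.ncard_range_of_injective (fun x y hxy => by
      simp only [Sym2.eq_iff, Fin.mk.injEq] at hxy
      ext <;> lia), Nat.card_prod, Nat.card_fin, Nat.card_fin]
  have hdisj : Disjoint B T := by
    rw [Set.disjoint_left]
    rintro _ ⟨x, rfl⟩ ⟨e, -, he⟩
    induction e with | _ i j
    simp only [Sym2.map_mk, Sym2.eq_iff, Fin.ext_iff, Fin.val_castLE] at he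
    lia
  rw [← hB, ← hT, ← Set.ncard_union_eq hdisj]
  refine Set.ncard_le_ncard (Set.union_subset ?_ ?_)
  · rintro _ ⟨x, rfl⟩
    exact turanKopylov_adj.2 ⟨by grind, .inl (.inr ⟨x.1.2, by simp⟩)⟩
  · rintro _ ⟨e, he, rfl⟩
    induction e with | _ i j
    rw [SimpleGraph.mem_edgeSet, turanGraph_adj] at he
    have hij : Fin.castLE hmn i ≠ Fin.castLE hmn j :=
      (Fin.castLE_injective hmn).ne fun hij => he (by rw [hij])
    exact turanKopylov_adj.2 ⟨hij, .inl (.inl ⟨by simp, by simp, by simpa using he⟩)⟩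

theorem exists_mem_twoConnEdgeCounts_gTuran_le {k r : ℕ} (hkn : k ≤ n) (ha : 2 ≤ a)
    (hak : a < k - a) (har : a + 2 ≤ r) : ∃ e ∈ twoConnEdgeCounts n r k, gTuran r n a k ≤ e := by
  have : Nontrivial (Fin r) := Fin.nontrivial_iff_two_le.2 (by lia)
  refine ⟨_, ⟨turanKopylov n (k - a) a (r - 1),
    turanKopylov_isTwoConnected ha hak (by lia) (by lia), ?_, ?_, rfl⟩, ?_⟩
  · have := turanKopylov_cliqueFree (n := n) (show a < r - 1 by lia) hak.le
    rwa [Nat.sub_add_cancel (by lia)] at this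
  · have := turanKopylov_longCycleFree (n := n) (p := r - 1) (by lia) hak (by lia)
    rwa [Nat.sub_add_cancel (by lia)] at this
  · rw [gTuran, extremalNumber_top, Fintype.card_fin, show n - k + a = n - (k - a) by lia]
    exact le_ncard_edgeSet_turanKopylov hak.le (by lia)

end Construction

theorem theorem4_general (n k r : ℕ) (hk : 5 ≤ k) (hkn : k ≤ n) (hr : (k - 1) / 2 + 2 ≤ r) :
    IsGreatest (twoConnEdgeCounts n r k)
      (max (gTuran r n 2 k) (gTuran r n ((k - 1) / 2) k)) := by
  classical
  have hub : max (gTuran r n 2 k) (gTuran r n ((k - 1) / 2) k) ∈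
      upperBounds (twoConnEdgeCounts n r k) := by
    rintro _ ⟨G, hG, hfree, hcyc, rfl⟩
    obtain ⟨a, ha, hak, hle⟩ := exists_card_edgeFinset_le_gTuran hk
      (by rwa [Fintype.card_fin]) hG hfree hcyc
    rw [Fintype.card_fin] at hle
    rw [← coe_edgeFinset, Set.ncard_coe_finset]
    exact hle.trans (gTuran_le_max (by lia) ha hak)
  obtain ⟨e, he, hle⟩ : ∃ e ∈ twoConnEdgeCounts n r k,
      max (gTuran r n 2 k) (gTuran r n ((k - 1) / 2) k) ≤ e := by
    obtain h | h := max_choice (gTuran r n 2 k) (gTuran r n ((k - 1) / 2) k) <;> rw [h]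
    · exact exists_mem_twoConnEdgeCounts_gTuran_le hkn le_rfl (by lia) (by lia)
    · exact exists_mem_twoConnEdgeCounts_gTuran_le hkn (by lia) (by lia) hr
  exact ⟨le_antisymm (hub he) hle ▸ he, hub⟩

theorem theorem4 (n k r : ℕ) (hk : 5 ≤ k) (hkn : k ≤ n)
    (hr : (k - 1) / 2 + 2 ≤ r) (hrk : r < k) :
    IsGreatest (twoConnEdgeCounts n r k)
      (max (gTuran r n 2 k) (gTuran r n ((k - 1) / 2) k)) :=
  theorem4_general n k r hk hkn hr
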